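/- Let $V$ be a finite set of $n$ points whose $3$-element subsets are each coloured red or blue. For distinct $u,v\in V$ the red (resp. blue) line $uv$ is the set consisting of $u$, $v$ and all $p\in V\setminus\{u,v\}$ such that $\{u,v,p\}$ is red (resp. blue). Let $m(V)$ be the number of distinct red lines plus the number of distinct blue lines (red and blue lines are counted separately), and let $m_3(V)$ be the number of red lines with exactly three points. Let $X$ be either a Euclidean space $\mathbb{R}^d$ with $d\ge 2$ or the real projective plane. For a finite set $V\subset X$, colour a triple of points of $V$ red if it is collinear in $X$, and blue otherwise. Then the following hold, with constants that do not depend on $X$ or on $n$. 1. There is a constant $C$ such that for every $n\ge 0$ $$\frac13\binom n2\;\le\;\min_{V\subset X,\ |V|=n} m(V)\;\le\;\frac13\binom n2+Cn .$$ In particular the minimum is $\frac13\binom n2+O(n)=\frac{n^2}{6}+O(n)$. 2. There is a constant $A$ such that for every $n\ge 0$ there is a set $V\subset X$ of $n$ points with $m_3(V)\ge\frac13\binom n2-An$. 3. For every $A$ there is a constant $C_A$ such that every set $V\subset X$ of $n$ points with $m_3(V)\ge\frac13\binom n2-An$ satisfies $m(V)\le\frac13\binom n2+C_An$. -/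

import Mathlib

/-- The two colours. -/
inductive Colour where
  | red
  | blue

/-- A bi-coloured system on the point set `V`: every 3-element subset of `V` gets a colour. -/
structure BicolouredSystem (V : Type*) where
  colour : {t : Set V // t.ncard = 3} → Colour

namespace BicolouredSystem

variable {V : Type*} (S : BicolouredSystem V)

/-- The line of colour `c` generated by `u` and `v`: the points `u`, `v` and all points `p`
such that `{u, v, p}` is a triple of colour `c`. -/
def line (c : Colour) (u v : V) : Set V :=
  {u, v} ∪ {p | ∃ h : ({u, v, p} : Set V).ncard = 3, S.colour ⟨{u, v, p}, h⟩ = c}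

/-- The set of all lines of colour `c`. -/
def lines (c : Colour) : Set (Set V) :=
  {L | ∃ u v : V, u ≠ v ∧ L = S.line c u v}

/-- The number of distinct red lines plus the number of distinct blue lines. -/
noncomputable def numLines : ℕ :=
  (S.lines Colour.red).ncard + (S.lines Colour.blue).ncard

/-- The number of red lines that consist of exactly three points. -/
noncomputable def numThreePointRedLines : ℕ :=
  {L ∈ S.lines Colour.red | L.ncard = 3}.ncard

end BicolouredSystem

open Classical in
/-- The bi-coloured system on a finite set `P` of points of `X` whose red triples are
the triples satisfying `coll`, regarded as the collinearity of subsets of `X`. -/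
noncomputable def collinearSystem {X : Type*} (coll : Set X → Prop) (P : Finset X) :
    BicolouredSystem P where
  colour t := if coll (Subtype.val '' t.1) then Colour.red else Colour.blue

/-- Collinearity in the Euclidean space of dimension `d`. -/
def euclideanCollinear (d : ℕ) (s : Set (EuclideanSpace ℝ (Fin d))) : Prop :=
  Collinear ℝ s

/-- The real projective plane. -/
abbrev RealProjectivePlane : Type := Projectivization ℝ (Fin 3 → ℝ)

/-- Collinearity in the real projective plane. -/
def projectiveCollinear (s : Set RealProjectivePlane) : Prop :=
  Projectivization.IsCollinear s

/-- The values taken by the total number of lines on the systems derived from `n` points. -/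
def totals {X : Type*} (coll : Set X → Prop) (n : ℕ) : Set ℕ :=
  {m | ∃ P : Finset X, P.card = n ∧ m = (collinearSystem coll P).numLines}

/-- In a Euclidean space collinearity of a triple is the metric notion: for some ordering of
the triple, two of the distances add up to the third. -/
theorem euclideanCollinear_triple_iff {d : ℕ} (a b c : EuclideanSpace ℝ (Fin d)) :
    euclideanCollinear d {a, b, c} ↔
      dist a b + dist b c = dist a c ∨ dist b c + dist c a = dist b a ∨
        dist c a + dist a b = dist c b := by
  rw [dist_add_dist_eq_iff, dist_add_dist_eq_iff, dist_add_dist_eq_iff]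
  refine ⟨fun h => Collinear.wbtw_or_wbtw_or_wbtw h, ?_⟩
  rintro (h | h | h)
  · exact h.collinear
  · have e : ({a, b, c} : Set (EuclideanSpace ℝ (Fin d))) = {b, c, a} := by ext; simp; tauto
    exact e ▸ h.collinear
  · have e : ({a, b, c} : Set (EuclideanSpace ℝ (Fin d))) = {c, a, b} := by ext; simp; tauto
    exact e ▸ h.collinear

/-! Both bounds count ordered pairs of distinct points by their red line. The counts use only that
any two points of a red line generate it (`IsLinear`), so Euclidean and projective collinearity are
treated alike through `IsLineGeometry`.

Lower bound: a red line with at most three points comes from at most 6 ordered pairs. A pair on a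
larger red line is recovered, up to order, from its blue line, which misses at least two points of
the red line and so determines it. With R red and B blue lines, n(n-1) ≤ 6R + 2B ≤ 6(R + B).

Upper bound: all but n(n-1) - 6 m_3 pairs span three-point red lines. Their blue lines are
complements of single points, so there are at most n of those (`IsLinear.numLines_le`).

Sets with large m_3 lie on the cubic y(1 + x^2) = x: points with distinct abscissas tan α, tan β,
tan γ are collinear iff α + β + γ is a multiple of π. For n suitably shifted, equally spaced angles,
the line of two points meets the set in one further point, except for at most 2n ordered pairs. -/

namespace BicolouredSystem

variable {V : Type*} (S : BicolouredSystem V)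

/-- Any two points of a red line generate that line. -/
def IsLinear : Prop :=
  ∀ u v a b : V, u ≠ v → a ≠ b → a ∈ S.line Colour.red u v → b ∈ S.line Colour.red u v →
    S.line Colour.red a b = S.line Colour.red u v

variable {S}

theorem left_mem_line (c : Colour) (u v : V) : u ∈ S.line c u v := by simp [line]

theorem right_mem_line (c : Colour) (u v : V) : v ∈ S.line c u v := by simp [line]

theorem mem_line_blue_iff {u v p : V} (huv : u ≠ v) :
    p ∈ S.line Colour.blue u v ↔ p = u ∨ p = v ∨ p ∉ S.line Colour.red u v := by
  by_cases hu : p = u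
  · simp [hu, left_mem_line]
  by_cases hv : p = v
  · simp [hv, right_mem_line]
  have h : ({u, v, p} : Set V).ncard = 3 := by
    rw [Set.ncard_eq_three]
    exact ⟨u, v, p, huv, Ne.symm hu, Ne.symm hv, rfl⟩
  simp only [line, Set.mem_union, Set.mem_insert_iff, Set.mem_singleton_iff, hu, hv,
    Set.mem_ofPred_eq, false_or, h, exists_true_left]
  cases S.colour ⟨{u, v, p}, h⟩ <;> simp

/-! ### Counting ordered pairs by the size of their red line -/

section Counting

variable [Fintype V]

open Classical in
/-- The ordered pairs of distinct points whose red line satisfies `p`. -/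
noncomputable def pairsWith (S : BicolouredSystem V) (p : Set V → Prop) : Finset (V × V) :=
  Finset.univ.filter fun x => x.1 ≠ x.2 ∧ p (S.line Colour.red x.1 x.2)

theorem mem_pairsWith {p : Set V → Prop} {x : V × V} :
    x ∈ S.pairsWith p ↔ x.1 ≠ x.2 ∧ p (S.line Colour.red x.1 x.2) := by
  simp [pairsWith]

theorem card_pairsWith_add (S : BicolouredSystem V) (p : Set V → Prop) :
    (S.pairsWith p).card + (S.pairsWith fun L => ¬ p L).card =
      Fintype.card V * (Fintype.card V - 1) := by
  classical
  have h : (S.pairsWith p) ∪ (S.pairsWith fun L => ¬ p L) = Finset.univ.offDiag := by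
    ext x
    simp only [Finset.mem_union, mem_pairsWith, Finset.mem_offDiag, Finset.mem_univ, true_and]
    tauto
  have hd : Disjoint (S.pairsWith p) (S.pairsWith fun L => ¬ p L) := by
    rw [Finset.disjoint_left]
    intro x hx hx'
    exact (mem_pairsWith.1 hx').2 (mem_pairsWith.1 hx).2
  rw [← Finset.card_union_of_disjoint hd, h, Finset.offDiag_card, Finset.card_univ,
    Nat.mul_sub_one]

open Classical in
/-- The ordered pairs generating a given red line are the pairs of its distinct points. -/
theorem IsLinear.filter_line_eq (hS : S.IsLinear) {p : Set V → Prop} {L : Set V}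
    (hL : L ∈ S.lines Colour.red) (hp : p L) :
    ((S.pairsWith p).filter fun x => S.line Colour.red x.1 x.2 = L) = L.toFinset.offDiag := by
  obtain ⟨u, v, huv, rfl⟩ := hL
  ext ⟨a, b⟩
  simp only [Finset.mem_filter, mem_pairsWith, Finset.mem_offDiag, Set.mem_toFinset]
  constructor
  · rintro ⟨⟨hab, -⟩, h⟩
    exact ⟨h ▸ left_mem_line _ _ _, h ▸ right_mem_line _ _ _, hab⟩
  · rintro ⟨ha, hb, hab⟩
    have h := hS u v a b huv hab ha hb
    exact ⟨⟨hab, h ▸ hp⟩, h⟩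

theorem card_image_line_le (c : Colour) (p : Set V → Prop) [DecidableEq (Set V)] :
    ((S.pairsWith p).image fun x => S.line c x.1 x.2).card ≤ (S.lines c).ncard := by
  rw [← Set.ncard_coe_finset]
  refine Set.ncard_le_ncard ?_ (Set.toFinite _)
  intro L hL
  simp only [Finset.coe_image, Set.mem_image, Finset.mem_coe, mem_pairsWith] at hL
  obtain ⟨x, hx, rfl⟩ := hL
  exact ⟨_, _, hx.1, rfl⟩

theorem IsLinear.card_pairsWith_three (hS : S.IsLinear) :
    (S.pairsWith fun L => L.ncard = 3).card = 6 * S.numThreePointRedLines := by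
  classical
  have h := Finset.card_eq_sum_card_fiberwise (s := S.pairsWith fun L => L.ncard = 3)
    (t := {L ∈ S.lines Colour.red | L.ncard = 3}.toFinset)
    (f := fun x => S.line Colour.red x.1 x.2) (by
      intro x hx
      have hx := mem_pairsWith.1 hx
      simp only [Set.coe_toFinset]
      exact ⟨⟨_, _, hx.1, rfl⟩, hx.2⟩)
  rw [h, Finset.sum_congr rfl (g := fun _ => 6), Finset.sum_const, numThreePointRedLines,
    Set.ncard_eq_toFinset_card', smul_eq_mul, mul_comm]
  intro L hL
  rw [Set.mem_toFinset] at hL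
  rw [hS.filter_line_eq hL.1 hL.2, Finset.offDiag_card, ← Set.ncard_eq_toFinset_card', hL.2]

theorem IsLinear.card_pairsWith_le_three (hS : S.IsLinear) :
    (S.pairsWith fun L => L.ncard ≤ 3).card ≤ 6 * (S.lines Colour.red).ncard := by
  classical
  refine (Finset.card_le_mul_card_image (f := fun x => S.line Colour.red x.1 x.2) _ 6 ?_).trans
    (Nat.mul_le_mul_left 6 (card_image_line_le _ _))
  intro L hL
  obtain ⟨x, hx, rfl⟩ := Finset.mem_image.1 hL
  have hx := mem_pairsWith.1 hx
  rw [hS.filter_line_eq ⟨_, _, hx.1, rfl⟩ hx.2, Finset.offDiag_card,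
    ← Set.ncard_eq_toFinset_card']
  have h3 := hx.2
  generalize (S.line Colour.red x.1 x.2).ncard = k at h3
  interval_cases k <;> simp

/-- A red line with at least four points is determined by the blue line of any two of its
points. -/
theorem IsLinear.line_red_eq_of_line_blue_eq (hS : S.IsLinear) {a b u v : V} (hab : a ≠ b)
    (huv : u ≠ v) (h4 : 3 < (S.line Colour.red a b).ncard)
    (h : S.line Colour.blue u v = S.line Colour.blue a b) :
    S.line Colour.red u v = S.line Colour.red a b := by
  -- Two points of the red line lie off `{a, b}`; the common blue line misses them, so both red
  -- lines contain them.
  have hcard : 1 < (S.line Colour.red a b \ {a, b}).ncard := by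
    have h1 := Set.ncard_le_ncard_sdiff_add_ncard (S.line Colour.red a b) {a, b}
    have h2 := Set.ncard_pair hab
    omega
  obtain ⟨c, hc, d, hd, hcd⟩ := Set.one_lt_ncard_iff_nontrivial.1 hcard
  have key : ∀ x ∈ S.line Colour.red a b \ {a, b}, x ∈ S.line Colour.red u v := by
    rintro x ⟨hx, hx'⟩
    have : x ∉ S.line Colour.blue u v := by
      rw [h, mem_line_blue_iff hab]
      simp only [Set.mem_insert_iff, Set.mem_singleton_iff] at hx'
      tauto
    rw [mem_line_blue_iff huv] at this
    exact not_not.1 fun hn => this (Or.inr (Or.inr hn))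
  rw [← hS u v c d huv hcd (key c hc) (key d hd), hS a b c d hab hcd hc.1 hd.1]

/-- The blue line determines the red one, and the two meet exactly in the generating pair; only its
order is lost. -/
theorem IsLinear.card_pairsWith_gt_three (hS : S.IsLinear) :
    (S.pairsWith fun L => ¬ L.ncard ≤ 3).card ≤ 2 * (S.lines Colour.blue).ncard := by
  classical
  refine (Finset.card_le_mul_card_image (f := fun x => S.line Colour.blue x.1 x.2) _ 2 ?_).trans
    (Nat.mul_le_mul_left 2 (card_image_line_le _ _))
  intro L hL
  obtain ⟨⟨a, b⟩, hx, rfl⟩ := Finset.mem_image.1 hL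
  obtain ⟨hab, h4⟩ := mem_pairsWith.1 hx
  simp only [not_le] at hab h4
  refine (Finset.card_le_card (t := {(a, b), (b, a)}) ?_).trans Finset.card_le_two
  rintro ⟨u, v⟩ huv
  simp only [Finset.mem_filter, mem_pairsWith] at huv
  obtain ⟨⟨huv, -⟩, h⟩ := huv
  have hred := hS.line_red_eq_of_line_blue_eq hab huv h4 h
  have key : ∀ x, x ∈ S.line Colour.blue u v → x ∈ S.line Colour.red u v → x = a ∨ x = b := by
    intro x hx hx'
    rw [h, mem_line_blue_iff hab] at hx
    rw [hred] at hx'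
    tauto
  have hu := key u (left_mem_line _ _ _) (left_mem_line _ _ _)
  have hv := key v (right_mem_line _ _ _) (right_mem_line _ _ _)
  simp only [Finset.mem_insert, Finset.mem_singleton, Prod.mk.injEq]
  rcases hu with rfl | rfl <;> rcases hv with rfl | rfl <;> simp_all

theorem IsLinear.card_mul_le_six_mul_numLines (hS : S.IsLinear) :
    Fintype.card V * (Fintype.card V - 1) ≤ 6 * S.numLines := by
  rw [← card_pairsWith_add S fun L => L.ncard ≤ 3, numLines]
  have h1 := hS.card_pairsWith_le_three
  have h2 := hS.card_pairsWith_gt_three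
  omega

/-- Each exceptional pair adds at most one line, which is enough when there are O(n) of them. -/
theorem ncard_lines_red_le (S : BicolouredSystem V) :
    (S.lines Colour.red).ncard ≤
      S.numThreePointRedLines + (S.pairsWith fun L => ¬ L.ncard = 3).card := by
  classical
  have hsub : S.lines Colour.red ⊆ {L ∈ S.lines Colour.red | L.ncard = 3} ∪
      ((S.pairsWith fun L => ¬ L.ncard = 3).image fun x => S.line Colour.red x.1 x.2 :
        Finset (Set V)) := by
    rintro L ⟨u, v, huv, rfl⟩
    by_cases h : (S.line Colour.red u v).ncard = 3
    · exact Or.inl ⟨⟨u, v, huv, rfl⟩, h⟩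
    · exact Or.inr (Finset.mem_coe.2 (Finset.mem_image.2 ⟨(u, v), mem_pairsWith.2 ⟨huv, h⟩, rfl⟩))
  refine (Set.ncard_le_ncard hsub (Set.toFinite _)).trans ((Set.ncard_union_le _ _).trans ?_)
  rw [Set.ncard_coe_finset]
  exact Nat.add_le_add_left Finset.card_image_le _

/-- The blue line of two points of a three-point red line misses exactly the third point. -/
theorem exists_line_blue_eq_compl_singleton {u v : V} (huv : u ≠ v)
    (h : (S.line Colour.red u v).ncard = 3) : ∃ w, S.line Colour.blue u v = {w}ᶜ := by
  have hsub : ({u, v} : Set V) ⊆ S.line Colour.red u v := Set.subset_union_left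
  have h1 : (S.line Colour.red u v \ {u, v}).ncard = 1 := by
    rw [Set.ncard_sdiff hsub, h, Set.ncard_pair huv]
  obtain ⟨w, hw⟩ := Set.ncard_eq_one.1 h1
  refine ⟨w, ?_⟩
  ext p
  have hp := Set.ext_iff.1 hw p
  simp only [Set.mem_sdiff, Set.mem_insert_iff, Set.mem_singleton_iff] at hp
  rw [mem_line_blue_iff huv, Set.mem_compl_iff, Set.mem_singleton_iff, ← hp]
  tauto

theorem ncard_lines_blue_le (S : BicolouredSystem V) :
    (S.lines Colour.blue).ncard ≤
      Fintype.card V + (S.pairsWith fun L => ¬ L.ncard = 3).card := by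
  classical
  have hsub : S.lines Colour.blue ⊆
      (Finset.univ.image fun w : V => ({w}ᶜ : Set V) : Finset (Set V)) ∪
      ((S.pairsWith fun L => ¬ L.ncard = 3).image fun x => S.line Colour.blue x.1 x.2 :
        Finset (Set V)) := by
    rintro L ⟨u, v, huv, rfl⟩
    by_cases h : (S.line Colour.red u v).ncard = 3
    · obtain ⟨w, hw⟩ := exists_line_blue_eq_compl_singleton huv h
      exact Or.inl (by simp [hw])
    · exact Or.inr (Finset.mem_coe.2 (Finset.mem_image.2 ⟨(u, v), mem_pairsWith.2 ⟨huv, h⟩, rfl⟩))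
  refine (Set.ncard_le_ncard hsub (Set.toFinite _)).trans ((Set.ncard_union_le _ _).trans ?_)
  rw [Set.ncard_coe_finset, Set.ncard_coe_finset]
  exact Nat.add_le_add Finset.card_image_le Finset.card_image_le

theorem cast_choose_two_div_three (n : ℕ) :
    (n.choose 2 : ℝ) / 3 = ((n * (n - 1) : ℕ) : ℝ) / 6 := by
  rw [Nat.cast_choose_two]
  -- The truncated `n - 1` needs n = 0 apart.
  rcases n with _ | n
  · simp
  · push_cast [Nat.add_sub_cancel]
    ring

theorem IsLinear.choose_two_div_three_le_numLines (hS : S.IsLinear) :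
    ((Fintype.card V).choose 2 : ℝ) / 3 ≤ S.numLines := by
  have h : ((Fintype.card V * (Fintype.card V - 1) : ℕ) : ℝ) ≤ (6 * S.numLines : ℕ) :=
    Nat.cast_le.2 hS.card_mul_le_six_mul_numLines
  rw [cast_choose_two_div_three]
  push_cast at h ⊢
  linarith

theorem IsLinear.numLines_le (hS : S.IsLinear) {A : ℝ}
    (hA : ((Fintype.card V).choose 2 : ℝ) / 3 - A * Fintype.card V ≤ S.numThreePointRedLines) :
    (S.numLines : ℝ) ≤
      ((Fintype.card V).choose 2 : ℝ) / 3 + (12 * A + 1) * Fintype.card V := by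
  have h1 := card_pairsWith_add S fun L => L.ncard = 3
  rw [hS.card_pairsWith_three] at h1
  have h2 : S.numLines ≤ S.numThreePointRedLines + (S.pairsWith fun L => ¬ L.ncard = 3).card +
      (Fintype.card V + (S.pairsWith fun L => ¬ L.ncard = 3).card) :=
    Nat.add_le_add S.ncard_lines_red_le S.ncard_lines_blue_le
  -- With N exceptional pairs the total is at most m_3 + n + 2N, where m_3 = (n(n-1) - N)/6 and N ≤
  -- 6An; dropping -N/6 leaves 12A + 1.
  rw [cast_choose_two_div_three, ← h1] at hA ⊢
  have h3 := (Nat.cast_le (α := ℝ)).2 h2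
  push_cast at h3 hA ⊢
  linarith [Nat.cast_nonneg (α := ℝ) (S.pairsWith fun L => ¬ L.ncard = 3).card]

theorem IsLinear.le_numThreePointRedLines (hS : S.IsLinear)
    (h : (S.pairsWith fun L => ¬ L.ncard = 3).card ≤ 2 * Fintype.card V) :
    ((Fintype.card V).choose 2 : ℝ) / 3 - 1 / 3 * Fintype.card V ≤ S.numThreePointRedLines := by
  have h1 := card_pairsWith_add S fun L => L.ncard = 3
  rw [hS.card_pairsWith_three] at h1
  rw [cast_choose_two_div_three, ← h1]
  have h3 := (Nat.cast_le (α := ℝ)).2 h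
  push_cast at h3 ⊢
  linarith

end Counting

end BicolouredSystem

/-! ### The cubic curve and its tangent parametrisation -/

/-- The points `(a, a / (1 + a ^ 2))`, `(b, b / (1 + b ^ 2))`, `(c, c / (1 + c ^ 2))` lie on
a line exactly if `a + b + c = a * b * c`. -/
theorem exists_combination_iff {a b c : ℝ} (hab : a ≠ b) (hac : a ≠ c) (hbc : b ≠ c) :
    (∃ r : ℝ, (1 - r) * a + r * b = c ∧
      (1 - r) * (a / (1 + a ^ 2)) + r * (b / (1 + b ^ 2)) = c / (1 + c ^ 2)) ↔
      a + b + c = a * b * c := by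
  have ha : 1 + a ^ 2 ≠ 0 := by positivity
  have hb : 1 + b ^ 2 ≠ 0 := by positivity
  have hc : 1 + c ^ 2 ≠ 0 := by positivity
  have hba : b - a ≠ 0 := sub_ne_zero.2 hab.symm
  have hca : c - a ≠ 0 := sub_ne_zero.2 hac.symm
  have hcb : c - b ≠ 0 := sub_ne_zero.2 hbc.symm
  -- The first coordinate forces `r`; the second then becomes a determinant that factors.
  have hdet : ∀ r : ℝ, r * (b - a) = c - a →
      ((1 - r) * (a / (1 + a ^ 2)) + r * (b / (1 + b ^ 2)) - c / (1 + c ^ 2)) *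
        ((1 + a ^ 2) * (1 + b ^ 2) * (1 + c ^ 2)) =
        (c - a) * (c - b) * (a + b + c - a * b * c) := by
    intro r hr
    obtain rfl : r = (c - a) / (b - a) := by rw [eq_div_iff hba, hr]
    field_simp
    ring
  constructor
  · rintro ⟨r, h1, h2⟩
    have h := hdet r (by linarith)
    rw [h2, sub_self, zero_mul, eq_comm, mul_eq_zero] at h
    exact sub_eq_zero.1 (h.resolve_left (mul_ne_zero hca hcb))
  · intro h
    refine ⟨(c - a) / (b - a), by field_simp; ring, ?_⟩
    have h' := hdet ((c - a) / (b - a)) (by field_simp)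
    rw [h, sub_self, mul_zero, mul_eq_zero] at h'
    exact sub_eq_zero.1 (h'.resolve_right (by positivity))

/-- Two solutions would force ab = 1 and a + b = 0, hence -a^2 = 1. -/
theorem eq_of_add_eq_mul {a b c d : ℝ} (hc : a + b + c = a * b * c)
    (hd : a + b + d = a * b * d) : c = d := by
  by_contra hcd
  have h1 : (c - d) * (1 - a * b) = 0 := by linear_combination hc - hd
  have h2 : a * b = 1 := by
    have := (mul_eq_zero.1 h1).resolve_left (sub_ne_zero.2 hcd)
    linarith
  obtain rfl : b = -a := by
    rw [h2] at hc
    linarith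
  nlinarith [sq_nonneg a]

open Real

/-- The angles `π (3 j + 1) / (3 n)`, `0 ≤ j < n`; the shift keeps them off `π / 2`. -/
noncomputable def curveAngle (n : ℕ) (j : ZMod n) : ℝ :=
  π * (3 * j.val + 1) / (3 * n)

/-- The tangents of the `n` angles `curveAngle n j`. -/
noncomputable def curveParam (n : ℕ) (j : ZMod n) : ℝ :=
  tan (curveAngle n j)

section Param

variable {n : ℕ} [NeZero n]

theorem curveAngle_mem_Ioo (j : ZMod n) : curveAngle n j ∈ Set.Ioo 0 π := by
  have hn : (0 : ℝ) < n := Nat.cast_pos.2 (NeZero.pos n)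
  have hj : (j.val : ℝ) + 1 ≤ n := by exact_mod_cast ZMod.val_lt j
  refine ⟨by unfold curveAngle; positivity, ?_⟩
  rw [curveAngle, div_lt_iff₀ (by positivity)]
  exact mul_lt_mul_of_pos_left (by linarith) pi_pos

theorem cos_curveAngle_ne_zero (j : ZMod n) : cos (curveAngle n j) ≠ 0 := by
  have hn : (n : ℝ) ≠ 0 := Nat.cast_ne_zero.2 (NeZero.ne n)
  rw [Real.cos_ne_zero_iff]
  intro k hk
  rw [curveAngle, div_eq_iff (by positivity)] at hk
  have h : π * (2 * (3 * j.val + 1) : ℝ) = π * (3 * ((2 * k + 1) * n)) := by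
    linear_combination 2 * hk
  have h' := mul_left_cancel₀ pi_ne_zero h
  have h'' : (2 * (3 * j.val + 1) : ℤ) = 3 * ((2 * k + 1) * n) := by exact_mod_cast h'
  -- The left side is 2 modulo 3, the right side 0.
  omega

theorem curveParam_injective : Function.Injective (curveParam n) := by
  intro i j hij
  have hn : (0 : ℝ) < n := Nat.cast_pos.2 (NeZero.pos n)
  have hi := curveAngle_mem_Ioo i
  have hj := curveAngle_mem_Ioo j
  rw [curveParam, curveParam, tan_eq_sin_div_cos, tan_eq_sin_div_cos,
    div_eq_div_iff (cos_curveAngle_ne_zero i) (cos_curveAngle_ne_zero j)] at hij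
  have hs : sin (curveAngle n i - curveAngle n j) = 0 := by
    rw [sin_sub]
    linear_combination hij
  have h0 := (sin_eq_zero_iff_of_lt_of_lt (by linarith [hi.1, hj.2]) (by linarith [hi.2, hj.1])).1 hs
  have h1 := sub_eq_zero.1 h0
  rw [curveAngle, curveAngle, div_left_inj' (by positivity)] at h1
  have h2 := mul_left_cancel₀ pi_ne_zero h1
  have h3 : i.val = j.val := by
    have : (i.val : ℝ) = j.val := by linarith
    exact_mod_cast this
  exact ZMod.val_injective n h3

/-- The three shifts of π/(3n) add up to π/n, so the angles sum to a multiple of π; divide the sine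
of the sum by the cosines. -/
theorem curveParam_add_add {i j k : ZMod n} (h : i + j + k + 1 = 0) :
    curveParam n i + curveParam n j + curveParam n k =
      curveParam n i * curveParam n j * curveParam n k := by
  have hn : (n : ℝ) ≠ 0 := Nat.cast_ne_zero.2 (NeZero.ne n)
  have hdvd : n ∣ i.val + j.val + k.val + 1 := by
    rw [← ZMod.natCast_eq_zero_iff]
    push_cast
    simpa using h
  obtain ⟨m, hm⟩ := hdvd
  have hm' : (i.val + j.val + k.val + 1 : ℝ) = n * m := by exact_mod_cast hm
  have hsum : curveAngle n i + curveAngle n j + curveAngle n k = m * π := by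
    unfold curveAngle
    field_simp
    linear_combination 3 * hm'
  have hsin : sin (curveAngle n i + curveAngle n j + curveAngle n k) = 0 := by
    rw [hsum, sin_nat_mul_pi]
  have hi := cos_curveAngle_ne_zero i
  have hj := cos_curveAngle_ne_zero j
  have hk := cos_curveAngle_ne_zero k
  rw [sin_add, sin_add, cos_add] at hsin
  simp only [curveParam, tan_eq_sin_div_cos]
  field_simp
  linear_combination hsin

end Param

/-! ### Line geometries containing the curve -/

/-- Pairs are collinear, and three points on the line through two distinct points are
collinear. -/
structure IsLineGeometry {X : Type*} (coll : Set X → Prop) : Prop where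
  pair : ∀ a b : X, coll {a, b}
  triple : ∀ u v a b c : X, u ≠ v → coll {u, v, a} → coll {u, v, b} → coll {u, v, c} →
    coll {a, b, c}

namespace IsLineGeometry

open BicolouredSystem

variable {X : Type*} {coll : Set X → Prop}

theorem mem_line_red_iff (h : IsLineGeometry coll) {P : Finset X} {u v p : P} (huv : u ≠ v) :
    p ∈ (collinearSystem coll P).line Colour.red u v ↔ coll {(u : X), (v : X), (p : X)} := by
  by_cases hu : p = u
  · subst hu
    simp only [left_mem_line, true_iff]
    have e : ({(p : X), (v : X), (p : X)} : Set X) = {(p : X), (v : X)} := by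
      ext; simp; tauto
    exact e ▸ h.pair _ _
  by_cases hv : p = v
  · subst hv
    simp only [right_mem_line, true_iff, Set.pair_eq_singleton]
    exact h.pair _ _
  have h3 : ({u, v, p} : Set P).ncard = 3 :=
    Set.ncard_eq_three.2 ⟨u, v, p, huv, Ne.symm hu, Ne.symm hv, rfl⟩
  simp [line, hu, hv, h3, collinearSystem, Set.image_insert_eq]

theorem isLinear (h : IsLineGeometry coll) (P : Finset X) : (collinearSystem coll P).IsLinear := by
  have key : ∀ u v a b p : P, u ≠ v → a ≠ b →
      a ∈ (collinearSystem coll P).line Colour.red u v →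
      b ∈ (collinearSystem coll P).line Colour.red u v →
      p ∈ (collinearSystem coll P).line Colour.red u v →
      p ∈ (collinearSystem coll P).line Colour.red a b := by
    intro u v a b p huv hab ha hb hp
    rw [h.mem_line_red_iff huv] at ha hb hp
    rw [h.mem_line_red_iff hab]
    exact h.triple _ _ _ _ _ (Subtype.coe_injective.ne huv) ha hb hp
  intro u v a b huv hab ha hb
  refine Set.Subset.antisymm (fun p hp => ?_) fun p hp => key u v a b p huv hab ha hb hp
  -- `u` and `v` lie on the line of `a` and `b`, so the roles can be exchanged.
  exact key a b u v p hab huv (key u v a b u huv hab ha hb (left_mem_line _ _ _))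
    (key u v a b v huv hab ha hb (right_mem_line _ _ _)) hp

variable {g : ℝ → X}

/-- The red line of two points of the curve consists of three points, unless the third
intersection with the curve is one of the two points. -/
theorem ncard_line_red_eq_three (h : IsLineGeometry coll)
    (hinj : Function.Injective g)
    (hg : ∀ a b c, a ≠ b → a ≠ c → b ≠ c → (coll {g a, g b, g c} ↔ a + b + c = a * b * c))
    {P : Finset X} {n : ℕ} [NeZero n] (hP : ∀ x, x ∈ P ↔ ∃ j, g (curveParam n j) = x)
    {i j : ZMod n} {u v : P} (hu : g (curveParam n i) = u) (hv : g (curveParam n j) = v)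
    (hij : i ≠ j) (hi : -1 - i - j ≠ i) (hj : -1 - i - j ≠ j) :
    ((collinearSystem coll P).line Colour.red u v).ncard = 3 := by
  have hinj' : Function.Injective fun k => g (curveParam n k) := hinj.comp curveParam_injective
  obtain ⟨w, hw⟩ : ∃ w : P, g (curveParam n (-1 - i - j)) = w :=
    ⟨⟨_, (hP _).2 ⟨_, rfl⟩⟩, rfl⟩
  have huv : u ≠ v := fun e => hij (hinj' (by simp only [hu, hv, e]))
  have huw : u ≠ w := fun e => hi (hinj' (by simp only [hu, hw, e]))
  have hvw : v ≠ w := fun e => hj (hinj' (by simp only [hv, hw, e]))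
  have hsum := curveParam_add_add (n := n) (i := i) (j := j) (k := -1 - i - j) (by ring)
  refine Set.ncard_eq_three.2 ⟨u, v, w, huv, huw, hvw, ?_⟩
  ext p
  simp only [Set.mem_insert_iff, Set.mem_singleton_iff]
  constructor
  · intro hp
    by_contra! hne
    obtain ⟨hpu, hpv, hpw⟩ := hne
    obtain ⟨k, hk⟩ := (hP p).1 p.2
    have hik : i ≠ k := fun e => hpu (Subtype.ext (by rw [← hk, ← hu, e]))
    have hjk : j ≠ k := fun e => hpv (Subtype.ext (by rw [← hk, ← hv, e]))
    rw [h.mem_line_red_iff huv, ← hu, ← hv, ← hk, hg _ _ _ (curveParam_injective.ne hij)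
      (curveParam_injective.ne hik) (curveParam_injective.ne hjk)] at hp
    exact hpw (Subtype.ext (by rw [← hk, ← hw, eq_of_add_eq_mul hp hsum]))
  · rintro (rfl | rfl | rfl)
    · exact left_mem_line _ _ _
    · exact right_mem_line _ _ _
    · rw [h.mem_line_red_iff huv, ← hu, ← hv, ← hw, hg _ _ _ (curveParam_injective.ne hij)
        (curveParam_injective.ne hi.symm) (curveParam_injective.ne hj.symm)]
      exact hsum

theorem exists_le_numThreePointRedLines (h : IsLineGeometry coll)
    (hinj : Function.Injective g)
    (hg : ∀ a b c, a ≠ b → a ≠ c → b ≠ c → (coll {g a, g b, g c} ↔ a + b + c = a * b * c))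
    (n : ℕ) : ∃ P : Finset X, P.card = n ∧
      (n.choose 2 : ℝ) / 3 - 1 / 3 * n ≤ (collinearSystem coll P).numThreePointRedLines := by
  classical
  -- `ZMod 0` is infinite, so n = 0 is separate.
  rcases Nat.eq_zero_or_pos n with rfl | hn
  · exact ⟨∅, rfl, by simp⟩
  have : NeZero n := ⟨hn.ne'⟩
  have hinj' : Function.Injective fun k => g (curveParam n k) := hinj.comp curveParam_injective
  let P : Finset X := Finset.univ.image fun k : ZMod n => g (curveParam n k)
  have hP : ∀ x, x ∈ P ↔ ∃ j, g (curveParam n j) = x := by simp [P]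
  have hcard : P.card = n := by
    rw [Finset.card_image_of_injective _ hinj', Finset.card_univ, ZMod.card]
  refine ⟨P, hcard, ?_⟩
  have hcard' : Fintype.card P = n := by simp [hcard]
  let q : ZMod n → P := fun k => ⟨g (curveParam n k), (hP _).2 ⟨k, rfl⟩⟩
  have hbad : ((collinearSystem coll P).pairsWith fun L => ¬ L.ncard = 3).card ≤
      2 * Fintype.card P := by
    -- An exceptional pair has its third index equal to one of its own, so it is (k, -1 - 2k) or its
    -- reverse.
    have hsub : (collinearSystem coll P).pairsWith (fun L => ¬ L.ncard = 3) ⊆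
        (Finset.univ.image fun k : ZMod n => (q k, q (-1 - k - k))) ∪
          Finset.univ.image fun k : ZMod n => (q (-1 - k - k), q k) := by
      rintro ⟨u, v⟩ huv
      obtain ⟨huv, h3⟩ := mem_pairsWith.1 huv
      obtain ⟨i, hi⟩ := (hP u).1 u.2
      obtain ⟨j, hj⟩ := (hP v).1 v.2
      have hqi : q i = u := Subtype.ext hi
      have hqj : q j = v := Subtype.ext hj
      have hij : i ≠ j := fun e => huv (by simp only [← hqi, ← hqj, e])
      simp only [Finset.mem_union, Finset.mem_image, Finset.mem_univ, true_and]
      by_cases h1 : -1 - i - j = i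
      · refine Or.inl ⟨i, ?_⟩
        rw [hqi, ← hqj]
        congr 2
        linear_combination h1
      by_cases h2 : -1 - i - j = j
      · refine Or.inr ⟨j, ?_⟩
        rw [hqj, ← hqi]
        congr 2
        linear_combination h2
      exact absurd (h.ncard_line_red_eq_three hinj hg hP hi hj hij h1 h2) h3
    refine (Finset.card_le_card hsub).trans ((Finset.card_union_le _ _).trans ?_)
    rw [two_mul, hcard']
    refine Nat.add_le_add (Finset.card_image_le.trans ?_) (Finset.card_image_le.trans ?_) <;>
      rw [Finset.card_univ, ZMod.card]
  have := (h.isLinear P).le_numThreePointRedLines hbad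
  rwa [hcard'] at this

theorem choose_two_div_three_le_numLines (h : IsLineGeometry coll) (P : Finset X) :
    (P.card.choose 2 : ℝ) / 3 ≤ (collinearSystem coll P).numLines := by
  simpa using (h.isLinear P).choose_two_div_three_le_numLines

theorem numLines_le (h : IsLineGeometry coll) {P : Finset X} {A : ℝ}
    (hA : (P.card.choose 2 : ℝ) / 3 - A * P.card ≤
      (collinearSystem coll P).numThreePointRedLines) :
    ((collinearSystem coll P).numLines : ℝ) ≤
      (P.card.choose 2 : ℝ) / 3 + (12 * A + 1) * P.card := by
  simpa using (h.isLinear P).numLines_le (A := A) (by simpa using hA)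

theorem exists_isLeast_totals (h : IsLineGeometry coll) {A : ℝ} {n : ℕ}
    (hex : ∃ P : Finset X, P.card = n ∧
      (n.choose 2 : ℝ) / 3 - A * n ≤ (collinearSystem coll P).numThreePointRedLines) :
    ∃ m : ℕ, IsLeast (totals coll n) m ∧ (n.choose 2 : ℝ) / 3 ≤ m ∧
      (m : ℝ) ≤ (n.choose 2 : ℝ) / 3 + (12 * A + 1) * n := by
  obtain ⟨P, rfl, hA⟩ := hex
  have hmem : (collinearSystem coll P).numLines ∈ totals coll P.card := ⟨P, rfl, rfl⟩
  have hle : IsLeast (totals coll P.card) (sInf (totals coll P.card)) :=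
    ⟨Nat.sInf_mem ⟨_, hmem⟩, fun _ hm => Nat.sInf_le hm⟩
  refine ⟨_, hle, ?_, (Nat.cast_le.2 (hle.2 hmem)).trans (h.numLines_le hA)⟩
  obtain ⟨Q, hQ, hm⟩ := hle.1
  rw [hm, ← hQ]
  exact h.choose_two_div_three_le_numLines Q

end IsLineGeometry

/-! ### Euclidean spaces -/

section Euclidean

theorem euclideanCollinear_iff_mem {d : ℕ} {u v p : EuclideanSpace ℝ (Fin d)} (huv : u ≠ v) :
    euclideanCollinear d {u, v, p} ↔ p ∈ line[ℝ, u, v] := by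
  refine ⟨fun h => Collinear.mem_affineSpan_of_mem_of_ne (p₁ := u) (p₂ := v) h (by simp)
    (by simp) (by simp) huv, fun h => ?_⟩
  exact collinear_triple_of_mem_affineSpan_pair (left_mem_affineSpan_pair ℝ u v)
    (right_mem_affineSpan_pair ℝ u v) h

theorem isLineGeometry_euclideanCollinear (d : ℕ) : IsLineGeometry (euclideanCollinear d) where
  pair a b := collinear_pair ℝ a b
  triple u v a b c huv ha hb hc := by
    rw [euclideanCollinear_iff_mem huv] at ha hb hc
    exact collinear_triple_of_mem_affineSpan_pair ha hb hc

/-- The curve `y = x / (1 + x ^ 2)` in the plane of the coordinates `i` and `j`. -/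
noncomputable def euclideanCurve {d : ℕ} (i j : Fin d) (t : ℝ) : EuclideanSpace ℝ (Fin d) :=
  EuclideanSpace.single i t + EuclideanSpace.single j (t / (1 + t ^ 2))

variable {d : ℕ} {i j : Fin d}

theorem euclideanCurve_injective (hij : i ≠ j) :
    Function.Injective (euclideanCurve i j) := by
  intro a b h
  have := congrArg (fun x : EuclideanSpace ℝ (Fin d) => x i) h
  simpa [euclideanCurve, hij] using this

theorem euclideanCollinear_curve_iff (hij : i ≠ j) (a b c : ℝ) (hab : a ≠ b) (hac : a ≠ c)
    (hbc : b ≠ c) :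
    euclideanCollinear d {euclideanCurve i j a, euclideanCurve i j b, euclideanCurve i j c} ↔
      a + b + c = a * b * c := by
  rw [euclideanCollinear_iff_mem ((euclideanCurve_injective hij).ne hab),
    ← exists_combination_iff hab hac hbc, mem_affineSpan_pair_iff_exists_lineMap_eq]
  refine exists_congr fun r => ?_
  rw [AffineMap.lineMap_apply_module]
  constructor
  · intro h
    have hi := congrArg (fun x : EuclideanSpace ℝ (Fin d) => x i) h
    have hj := congrArg (fun x : EuclideanSpace ℝ (Fin d) => x j) h
    simp [euclideanCurve, hij, hij.symm] at hi hj
    exact ⟨hi, hj⟩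
  · rintro ⟨h1, h2⟩
    ext k
    by_cases hki : k = i
    · subst hki
      simpa [euclideanCurve, hij] using h1
    by_cases hkj : k = j
    · subst hkj
      simpa [euclideanCurve, hij, hij.symm] using h2
    · simp [euclideanCurve, hki, hkj]

end Euclidean

/-! ### The real projective plane -/

section Projective

open Projectivization

/-- The span already has rank 2, so any subspace of rank at most 2 containing both vectors equals
it. -/
theorem isCollinear_mk_iff {u v p : Fin 3 → ℝ} (hu : u ≠ 0) (hv : v ≠ 0) (hp : p ≠ 0)
    (huv : mk ℝ u hu ≠ mk ℝ v hv) :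
    projectiveCollinear {mk ℝ u hu, mk ℝ v hv, mk ℝ p hp} ↔ p ∈ Submodule.span ℝ {u, v} := by
  have hli := huv
  rw [← independent_pair_iff_ne, independent_mk_iff_LinearIndependent] at hli
  have hrank : Module.finrank ℝ (Submodule.span ℝ {u, v}) = 2 := by
    rw [← Matrix.range_cons_cons_empty u v ![]]
    simp [finrank_span_eq_card hli]
  constructor
  · rintro ⟨M, -, hM, hsub⟩
    obtain ⟨W, rfl⟩ : ∃ W : Submodule ℝ (Fin 3 → ℝ), W.projectivization = M :=
      ⟨M.submodule, Subspace.submodule.symm_apply_apply M⟩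
    rw [Subspace.submodule.apply_symm_apply] at hM
    simp only [Set.insert_subset_iff, Set.singleton_subset_iff, SetLike.mem_coe,
      Submodule.mk_mem_projectivization_iff] at hsub
    have hle : Submodule.span ℝ {u, v} ≤ W := by
      rw [Submodule.span_le, Set.insert_subset_iff, Set.singleton_subset_iff]
      exact ⟨hsub.1, hsub.2.1⟩
    rw [Submodule.eq_of_le_of_finrank_le hle (hM.trans hrank.ge)]
    exact hsub.2.2
  · intro h
    refine ⟨(Submodule.span ℝ {u, v}).projectivization, ?_, ?_, ?_⟩
    · infer_instance
    · rw [Subspace.submodule.apply_symm_apply, hrank]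
    · simp only [Set.insert_subset_iff, Set.singleton_subset_iff, SetLike.mem_coe,
        Submodule.mk_mem_projectivization_iff]
      exact ⟨Submodule.subset_span (by simp), Submodule.subset_span (by simp), h⟩

theorem isLineGeometry_projectiveCollinear : IsLineGeometry projectiveCollinear where
  pair a b := isCollinear_pair a b
  triple u v a b c huv ha hb hc := by
    induction u using ind with | h u hu =>
    induction v using ind with | h v hv =>
    induction a using ind with | h a ha' =>
    induction b using ind with | h b hb' =>
    induction c using ind with | h c hc' =>
    have hli := huv
    rw [← independent_pair_iff_ne, independent_mk_iff_LinearIndependent] at hli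
    rw [isCollinear_mk_iff _ _ _ huv] at ha hb hc
    refine ⟨(Submodule.span ℝ {u, v}).projectivization, ?_, ?_, ?_⟩
    · infer_instance
    · rw [Subspace.submodule.apply_symm_apply, ← Matrix.range_cons_cons_empty u v ![]]
      simp [finrank_span_eq_card hli]
    · simp only [Set.insert_subset_iff, Set.singleton_subset_iff, SetLike.mem_coe,
        Submodule.mk_mem_projectivization_iff]
      exact ⟨ha, hb, hc⟩

/-- The curve `y = x / (1 + x ^ 2)` in an affine chart of the projective plane. -/
noncomputable def projectiveCurve (t : ℝ) : RealProjectivePlane :=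
  mk ℝ ![1, t, t / (1 + t ^ 2)] fun h => one_ne_zero (congrFun h 0)

theorem projectiveCurve_injective : Function.Injective projectiveCurve := by
  intro a b h
  rw [projectiveCurve, projectiveCurve, mk_eq_mk_iff'] at h
  obtain ⟨r, hr⟩ := h
  have h0 := congrFun hr 0
  have h1 := congrFun hr 1
  simp at h0 h1
  rw [← h1, h0, one_mul]

theorem projectiveCollinear_curve_iff (a b c : ℝ) (hab : a ≠ b) (hac : a ≠ c) (hbc : b ≠ c) :
    projectiveCollinear {projectiveCurve a, projectiveCurve b, projectiveCurve c} ↔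
      a + b + c = a * b * c := by
  rw [projectiveCurve, projectiveCurve, projectiveCurve,
    isCollinear_mk_iff _ _ _ (projectiveCurve_injective.ne hab),
    ← exists_combination_iff hab hac hbc, Submodule.mem_span_pair]
  constructor
  · rintro ⟨s, r, h⟩
    have h0 := congrFun h 0
    have h1 := congrFun h 1
    have h2 := congrFun h 2
    simp at h0 h1 h2
    -- The chart coordinate 1 gives s + r = 1.
    obtain rfl : s = 1 - r := by linarith
    exact ⟨r, h1, h2⟩
  · rintro ⟨r, h1, h2⟩
    refine ⟨1 - r, r, ?_⟩
    ext k
    fin_cases k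
    · simp
    · simpa using h1
    · simpa using h2

end Projective

theorem mainTheorem5 :
    -- the minimum total number of lines is `C(n,2)/3 + O(n)`, and at least `C(n,2)/3`
    (∃ C : ℝ, ∀ n : ℕ,
      (∀ d : ℕ, 2 ≤ d → ∃ m : ℕ, IsLeast (totals (euclideanCollinear d) n) m ∧
        (n.choose 2 : ℝ) / 3 ≤ m ∧ (m : ℝ) ≤ (n.choose 2 : ℝ) / 3 + C * n) ∧
      (∃ m : ℕ, IsLeast (totals projectiveCollinear n) m ∧
        (n.choose 2 : ℝ) / 3 ≤ m ∧ (m : ℝ) ≤ (n.choose 2 : ℝ) / 3 + C * n)) ∧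
    -- there are `n`-point sets with `C(n,2)/3 - O(n)` three-point lines
    (∃ A : ℝ, ∀ n : ℕ,
      (∀ d : ℕ, 2 ≤ d → ∃ P : Finset (EuclideanSpace ℝ (Fin d)), P.card = n ∧
        (n.choose 2 : ℝ) / 3 - A * n ≤
          (collinearSystem (euclideanCollinear d) P).numThreePointRedLines) ∧
      (∃ P : Finset RealProjectivePlane, P.card = n ∧
        (n.choose 2 : ℝ) / 3 - A * n ≤
          (collinearSystem projectiveCollinear P).numThreePointRedLines)) ∧
    -- and every such point set has at most `C(n,2)/3 + O(n)` lines in total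
    (∀ A : ℝ, ∃ C : ℝ, ∀ n : ℕ,
      (∀ d : ℕ, 2 ≤ d → ∀ P : Finset (EuclideanSpace ℝ (Fin d)), P.card = n →
        (n.choose 2 : ℝ) / 3 - A * n ≤
          (collinearSystem (euclideanCollinear d) P).numThreePointRedLines →
        ((collinearSystem (euclideanCollinear d) P).numLines : ℝ) ≤
          (n.choose 2 : ℝ) / 3 + C * n) ∧
      (∀ P : Finset RealProjectivePlane, P.card = n →
        (n.choose 2 : ℝ) / 3 - A * n ≤
          (collinearSystem projectiveCollinear P).numThreePointRedLines →
        ((collinearSystem projectiveCollinear P).numLines : ℝ) ≤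
          (n.choose 2 : ℝ) / 3 + C * n)) := by
  have hE : ∀ n d : ℕ, 2 ≤ d → ∃ P : Finset (EuclideanSpace ℝ (Fin d)), P.card = n ∧
      (n.choose 2 : ℝ) / 3 - 1 / 3 * n ≤
        (collinearSystem (euclideanCollinear d) P).numThreePointRedLines := by
    intro n d hd
    -- d ≥ 2 supplies the two coordinates of the curve.
    have hij : (⟨0, by omega⟩ : Fin d) ≠ ⟨1, by omega⟩ := by simp
    exact (isLineGeometry_euclideanCollinear d).exists_le_numThreePointRedLines
      (euclideanCurve_injective hij) (euclideanCollinear_curve_iff hij) n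
  have hP : ∀ n : ℕ, ∃ P : Finset RealProjectivePlane, P.card = n ∧
      (n.choose 2 : ℝ) / 3 - 1 / 3 * n ≤
        (collinearSystem projectiveCollinear P).numThreePointRedLines :=
    isLineGeometry_projectiveCollinear.exists_le_numThreePointRedLines
      projectiveCurve_injective projectiveCollinear_curve_iff
  refine ⟨⟨12 * (1 / 3) + 1, fun n => ⟨fun d hd => ?_, ?_⟩⟩,
    ⟨1 / 3, fun n => ⟨hE n, hP n⟩⟩, fun A => ⟨12 * A + 1, fun n => ⟨?_, ?_⟩⟩⟩
  · exact (isLineGeometry_euclideanCollinear d).exists_isLeast_totals (hE n d hd)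
  · exact isLineGeometry_projectiveCollinear.exists_isLeast_totals (hP n)
  · rintro d - P rfl h
    exact (isLineGeometry_euclideanCollinear d).numLines_le h
  · rintro P rfl h
    exact isLineGeometry_projectiveCollinear.numLines_le h
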